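/- For a finite group $G$ let $\mathrm{cd}(G)=\{\chi(1) : \chi\in\mathrm{Irr}(G)\}$ be the set of degrees of the complex irreducible characters of $G$. The character degree graph $\Delta(G)$ is the simple graph whose vertices are the primes dividing some element of $\mathrm{cd}(G)$, two distinct primes $p,q$ being adjacent if and only if $pq$ divides some element of $\mathrm{cd}(G)$. Theorem 3.5. Let $n\ge 4$ be an even integer. Every $(n-2)$-regular simple graph on $n$ vertices is isomorphic to the character degree graph $\Delta(G)$ of some finite solvable group $G$. -/

import Mathlib

namespace CharDegree

/-- The set `Irr(G)` of complex irreducible characters of `G`: the characters of the irreducible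
finite-dimensional complex representations of `G`. -/
def Irr (G : Type*) [Group G] : Set (G → ℂ) :=
  {χ | ∃ (V : Type) (_ : AddCommGroup V) (_ : Module ℂ V) (_ : FiniteDimensional ℂ V)
    (ρ : Representation ℂ G V), ρ.IsIrreducible ∧ ρ.character = χ}

/-- The set `cd(G)` of the degrees `χ(1)` of the complex irreducible characters of `G`. -/
def cd (G : Type*) [Group G] : Set ℕ :=
  {d | ∃ χ ∈ Irr G, χ 1 = (d : ℂ)}

/-- The set of all primes that divide some degree in `cd(G)`. -/
def degreePrimes (G : Type*) [Group G] : Set ℕ :=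
  {p | p.Prime ∧ ∃ d ∈ cd G, p ∣ d}

/-- The character degree graph `Δ(G)`: its vertices are the primes dividing some degree in `cd(G)`,
and two distinct primes `p`, `q` are adjacent when `p * q` divides some degree in `cd(G)`. -/
def degreeGraph (G : Type*) [Group G] : SimpleGraph (degreePrimes G) where
  Adj p q := p ≠ q ∧ ∃ d ∈ cd G, (p : ℕ) * (q : ℕ) ∣ d
  symm := ⟨fun p q h => ⟨h.1.symm, by simpa only [mul_comm] using h.2⟩⟩
  loopless := ⟨fun _ h => h.1 rfl⟩

end CharDegree

/-! In an `(n - 2)`-regular graph on `n` vertices every vertex misses exactly one other, so the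
complement is a perfect matching: two vertices are adjacent exactly when they lie in different
pairs. To each pair assign primes `r`, `p` with `p ≡ 1 (mod r)`, all primes distinct (Dirichlet),
and take a solvable group whose degrees are exactly `1`, `r`, `p`. Degrees of a direct product are
products of degrees (`mem_cd_prod_iff`), so two of the chosen primes divide a common degree exactly
when they come from different factors.

The factor is the Heisenberg group over `ZMod p` extended by scalars of order `r` acting with
weights `a`, `a⁻¹` on `x`, `y`, hence trivially on the centre. This centralisation keeps `r * p`
from being a degree: if the centre acts nontrivially the degree is `p`; if only the centre acts
trivially, the torus permutes the nontrivial characters of `(ZMod p)²` freely and the degree is `r`;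
otherwise it is `1`. The first two cases count a spanning set of eigenvectors via
`IsIrreducible.finrank_eq_card`. -/

open Module TensorProduct

namespace Representation

/-! ### Irreducibility, Maschke and Schur -/

section General

variable {k G V W : Type*} [Field k] [Group G] [AddCommGroup V] [Module k V]
  [AddCommGroup W] [Module k W]

theorem isIrreducible_iff_forall {ρ : Representation k G V} :
    ρ.IsIrreducible ↔ Nontrivial V ∧
      ∀ U : Submodule k V, (∀ g, ∀ v ∈ U, ρ g v ∈ U) → U = ⊥ ∨ U = ⊤ := by
  constructor
  · intro h
    refine ⟨?_, fun U hU => ?_⟩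
    · by_contra hV
      rw [not_nontrivial_iff_subsingleton] at hV
      exact bot_ne_top (α := Subrepresentation ρ)
        (Subrepresentation.toSubmodule_injective (Subsingleton.elim _ _))
    · rcases eq_bot_or_eq_top (⟨U, fun g v hv => hU g v hv⟩ : Subrepresentation ρ) with h | h
      · exact Or.inl (congrArg Subrepresentation.toSubmodule h)
      · exact Or.inr (congrArg Subrepresentation.toSubmodule h)
  · rintro ⟨hV, h⟩
    refine { exists_pair_ne := ⟨⊥, ⊤, fun e => ?_⟩, eq_bot_or_eq_top := fun σ => ?_ }
    · exact bot_ne_top (α := Submodule k V) (congrArg Subrepresentation.toSubmodule e)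
    · exact (h σ.toSubmodule fun g v hv => σ.apply_mem_toSubmodule g hv).imp
        (fun e => Subrepresentation.toSubmodule_injective e)
        (fun e => Subrepresentation.toSubmodule_injective e)

theorem isIrreducible_toRepresentation_of_isAtom {ρ : Representation k G V}
    {σ : Subrepresentation ρ} (hσ : IsAtom σ) : σ.toRepresentation.IsIrreducible := by
  rw [isIrreducible_iff_forall]
  constructor
  · rw [Submodule.nontrivial_iff_ne_bot]
    exact fun e => hσ.1 (Subrepresentation.toSubmodule_injective e)
  · intro U hU
    let τ : Subrepresentation ρ := ⟨U.map σ.toSubmodule.subtype, by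
      rintro g _ ⟨u, hu, rfl⟩
      exact ⟨_, hU g u hu, rfl⟩⟩
    have hle : τ ≤ σ := by
      rintro _ ⟨u, hu, rfl⟩
      exact u.2
    rcases hle.eq_or_lt with e | e
    · right
      have e' : U.map σ.toSubmodule.subtype = σ.toSubmodule :=
        congrArg Subrepresentation.toSubmodule e
      apply Submodule.map_injective_of_injective σ.toSubmodule.injective_subtype
      rw [e', Submodule.map_subtype_top]
    · left
      have e' : U.map σ.toSubmodule.subtype = ⊥ :=
        congrArg Subrepresentation.toSubmodule (hσ.2 τ e)
      exact Submodule.map_injective_of_injective σ.toSubmodule.injective_subtype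
        (by rw [e', Submodule.map_bot])

variable [Finite G] [CharZero k]

/-- The irreducible subrepresentations of a representation span it: a property of vectors closed
under addition which holds on them holds everywhere. -/
theorem induction_isAtom (ρ : Representation k G V) {P : V → Prop} (h0 : P 0)
    (hadd : ∀ v w, P v → P w → P (v + w))
    (hP : ∀ σ : Subrepresentation ρ, IsAtom σ → ∀ v ∈ σ, P v) (v : V) : P v := by
  -- Invertibility of the group order gives Maschke's theorem, so the module is the sum of its
  -- simple submodules.
  have : NeZero (Nat.card G : k) := ⟨by exact_mod_cast Nat.card_pos.ne'⟩
  let e := Subrepresentation.subrepresentationSubmoduleOrderIso (ρ := ρ)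
  have hv : ρ.asModuleEquiv.symm v ∈
      ⨆ N : {N : Submodule (MonoidAlgebra k G) ρ.asModule // IsAtom N}, N.1 := by
    have htop : ⨆ N : {N : Submodule (MonoidAlgebra k G) ρ.asModule // IsAtom N}, N.1 = ⊤ :=
      (sSup_eq_iSup' {N : Submodule (MonoidAlgebra k G) ρ.asModule | IsAtom N}).symm.trans
        sSup_atoms_eq_top
    rw [htop]
    trivial
  refine Submodule.iSup_induction _ (motive := fun w => P (ρ.asModuleEquiv w)) hv ?_ h0 ?_
  · rintro ⟨N, hN⟩ w hw
    exact hP (e.symm N) ((e.symm.isAtom_iff N).2 hN) w hw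
  · exact fun a b => hadd a b

/-- If `g` acts nontrivially on a representation, it does so on an irreducible constituent. -/
theorem exists_isAtom_apply_ne (ρ : Representation k G V) (g : G) (h : ρ g ≠ 1) :
    ∃ σ : Subrepresentation ρ, IsAtom σ ∧ ∃ v ∈ σ, ρ g v ≠ v := by
  by_contra! hc
  exact h (LinearMap.ext fun v => induction_isAtom ρ (P := fun v => ρ g v = v) (map_zero _)
    (fun v w hv hw => by rw [map_add, hv, hw]) hc v)

theorem exists_isAtom [Nontrivial V] (ρ : Representation k G V) :
    ∃ σ : Subrepresentation ρ, IsAtom σ := by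
  by_contra! hc
  obtain ⟨v, hv⟩ := exists_ne (0 : V)
  exact hv (induction_isAtom ρ (P := fun v => v = 0) rfl
    (fun v w hv hw => by rw [hv, hw, add_zero]) (fun σ hσ => absurd hσ (hc σ)) v)

/-- A commuting family of operators coming from a finite commutative group has a common
eigenvector. -/
theorem exists_eigenvector {A : Type*} [CommGroup A] [Finite A] [IsAlgClosed k]
    [FiniteDimensional k V] [Nontrivial V] (ρ : Representation k A V) :
    ∃ v : V, v ≠ 0 ∧ ∃ χ : A →* k, ∀ a, ρ a v = χ a • v := by
  obtain ⟨σ, hσ⟩ := exists_isAtom ρ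
  have := isIrreducible_toRepresentation_of_isAtom hσ
  have h1 := IsIrreducible.finrank_eq_one_of_isMulCommutative σ.toRepresentation
  obtain ⟨⟨v, hv⟩, hv0, hspan⟩ := finrank_eq_one_iff'.1 h1
  have hv0' : v ≠ 0 := fun e => hv0 (Subtype.ext e)
  have hex : ∀ a, ∃ c : k, ρ a v = c • v := fun a => by
    obtain ⟨c, hc⟩ := hspan ⟨ρ a v, σ.apply_mem_toSubmodule a hv⟩
    exact ⟨c, (congrArg Subtype.val hc).symm⟩
  choose c hc using hex
  refine ⟨v, hv0', ⟨⟨c, ?_⟩, ?_⟩, hc⟩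
  · apply smul_left_injective k hv0'
    simp [← hc]
  · intro a b
    apply smul_left_injective k hv0'
    simp only
    rw [← hc, map_mul, Module.End.mul_apply, hc, map_smul, hc, smul_smul, mul_comm]

/-- A converse to Schur's lemma: Maschke provides an equivariant projection onto any
subrepresentation, which must be a scalar; it fixes a nonzero vector unless the subrepresentation is
zero, so the scalar is `1`. -/
theorem isIrreducible_of_finrank_intertwiningMap_eq_one (ρ : Representation k G V)
    (h : finrank k (IntertwiningMap ρ ρ) = 1) : ρ.IsIrreducible := by
  have : NeZero (Nat.card G : k) := ⟨by exact_mod_cast Nat.card_pos.ne'⟩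
  rw [irreducible_iff_isSimpleModule_asModule]
  have hnt : Nontrivial (IntertwiningMap ρ ρ) := Module.nontrivial_of_finrank_pos (R := k) (by omega)
  have hV : Nontrivial ρ.asModule := by
    by_contra hV
    rw [not_nontrivial_iff_subsingleton] at hV
    obtain ⟨f, hf⟩ := exists_ne (0 : IntertwiningMap ρ ρ)
    exact hf (by ext v; exact hV.elim _ _)
  obtain ⟨f₀, hf₀, hspan⟩ := finrank_eq_one_iff'.1 h
  have hscalar : ∀ f : IntertwiningMap ρ ρ, ∃ c : k, f = c • 1 := by
    intro f
    obtain ⟨c, hc⟩ := hspan 1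
    obtain ⟨d, hd⟩ := hspan f
    have hc0 : c ≠ 0 := by
      rintro rfl
      rw [zero_smul] at hc
      exact one_ne_zero hc.symm
    exact ⟨d * c⁻¹, by rw [← hc, smul_smul, inv_mul_cancel_right₀ hc0, hd]⟩
  rw [isSimpleModule_iff]
  refine { eq_bot_or_eq_top := fun N => ?_ }
  obtain ⟨N', hN'⟩ := exists_isCompl N
  let π : ρ.asModule →ₗ[MonoidAlgebra k G] ρ.asModule := N.subtype ∘ₗ N.projectionOnto N' hN'
  obtain ⟨c, hc⟩ := hscalar ((IntertwiningMap.equivLinearMapAsModule ρ ρ).symm π)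
  have hc' : ∀ v : ρ.asModule, π v = c • v :=
    fun v => congrArg (fun f : IntertwiningMap ρ ρ => f v) hc
  have hπ : ∀ n ∈ N, π n = n := fun n hn =>
    congrArg Subtype.val (Submodule.projectionOnto_apply_left hN' ⟨n, hn⟩)
  by_cases hN : N = ⊥
  · exact Or.inl hN
  · right
    obtain ⟨n, hn, hn0⟩ := N.ne_bot_iff.1 hN
    have hc1 : c = 1 := smul_left_injective k hn0 (by
      simp only [one_smul]; rw [← hc', hπ n hn])
    rw [eq_top_iff]
    intro v _
    have := hc' v
    rw [hc1, one_smul] at this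
    rw [← this]
    exact (N.projectionOnto N' hN' v).2

end General

/-! ### Irreducible representations of a direct product -/

section ExternalTensor

variable {k G H V W : Type*} [Field k] [Group G] [Group H] [AddCommGroup V] [Module k V]
  [AddCommGroup W] [Module k W]

/-- The external tensor product of representations of `G` and `H`, a representation of `G × H`. -/
noncomputable def externalTensor (ρ : Representation k G V) (σ : Representation k H W) :
    Representation k (G × H) (V ⊗[k] W) :=
  tprod (ρ.comp (MonoidHom.fst G H)) (σ.comp (MonoidHom.snd G H))

theorem character_externalTensor [FiniteDimensional k V] [FiniteDimensional k W]
    (ρ : Representation k G V) (σ : Representation k H W) (x : G × H) :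
    (externalTensor ρ σ).character x = ρ.character x.1 * σ.character x.2 := by
  rw [externalTensor, char_tensor]
  rfl

theorem IsIrreducible.sum_char_mul_char_inv [Fintype G] [CharZero k] [IsAlgClosed k]
    [FiniteDimensional k V] {ρ : Representation k G V} (hρ : ρ.IsIrreducible) :
    ∑ g : G, ρ.character g * ρ.character g⁻¹ = Nat.card G := by
  have hG : (Nat.card G : k) ≠ 0 := by exact_mod_cast Nat.card_pos.ne'
  let := invertibleOfNonzero hG
  have h := card_inv_mul_sum_char_mul_char_eq_finrank ρ ρ
  rw [IsIrreducible.finrank_intertwiningMap_self, Nat.cast_one, inv_mul_eq_iff_eq_mul₀ hG,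
    mul_one] at h
  exact h

theorem isIrreducible_of_sum_char_mul_char_inv [Fintype G] [CharZero k]
    [FiniteDimensional k V] {ρ : Representation k G V}
    (h : ∑ g : G, ρ.character g * ρ.character g⁻¹ = Nat.card G) : ρ.IsIrreducible := by
  have hG : (Nat.card G : k) ≠ 0 := by exact_mod_cast Nat.card_pos.ne'
  let := invertibleOfNonzero hG
  have h' := card_inv_mul_sum_char_mul_char_eq_finrank ρ ρ
  rw [h, inv_mul_cancel₀ hG] at h'
  exact isIrreducible_of_finrank_intertwiningMap_eq_one ρ (by exact_mod_cast h'.symm)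

/-- The character norm of an external tensor product is the product of the two norms, and norm one
characterises irreducibility. -/
theorem IsIrreducible.externalTensor [Finite G] [Finite H] [CharZero k] [IsAlgClosed k]
    [FiniteDimensional k V] [FiniteDimensional k W] {ρ : Representation k G V}
    {σ : Representation k H W} (hρ : ρ.IsIrreducible) (hσ : σ.IsIrreducible) :
    (externalTensor ρ σ).IsIrreducible := by
  have := Fintype.ofFinite G
  have := Fintype.ofFinite H
  apply isIrreducible_of_sum_char_mul_char_inv
  rw [Nat.card_prod, Nat.cast_mul, ← hρ.sum_char_mul_char_inv, ← hσ.sum_char_mul_char_inv,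
    Fintype.sum_prod_type, Finset.sum_mul_sum]
  refine Finset.sum_congr rfl fun g _ => Finset.sum_congr rfl fun h _ => ?_
  rw [character_externalTensor, character_externalTensor]
  simp only [Prod.fst_inv, Prod.snd_inv]
  ring

/-- If there is a nonzero equivariant bilinear map from irreducible representations of `G` and `H`
to an irreducible representation of `G × H`, then the dimensions multiply. -/
theorem IsIrreducible.finrank_eq_mul {U : Type*} [AddCommGroup U] [Module k U]
    [Finite G] [Finite H] [CharZero k] [IsAlgClosed k] [FiniteDimensional k V]
    [FiniteDimensional k W] {ρ : Representation k G V} {σ : Representation k H W}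
    {τ : Representation k (G × H) U} (hρ : ρ.IsIrreducible) (hσ : σ.IsIrreducible)
    (hτ : τ.IsIrreducible) (f : V →ₗ[k] W →ₗ[k] U)
    (hf : ∀ g h v w, f (ρ g v) (σ h w) = τ (g, h) (f v w)) (hf0 : f ≠ 0) :
    finrank k U = finrank k V * finrank k W := by
  let φ : IntertwiningMap (Representation.externalTensor ρ σ) τ :=
    ⟨TensorProduct.lift f, by
      rintro ⟨g, h⟩
      exact TensorProduct.ext' fun v w => hf g h v w⟩
  have hirr := hρ.externalTensor hσ
  have hφ : φ ≠ 0 := fun e => hf0 <| by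
    ext v w
    exact LinearMap.congr_fun (congrArg IntertwiningMap.toLinearMap e) (v ⊗ₜ[k] w)
  have hbij := (IsIrreducible.bijective_or_eq_zero φ).resolve_right hφ
  rw [← finrank_tensorProduct]
  exact (LinearEquiv.ofBijective φ.toLinearMap hbij).finrank_eq.symm

/-- An irreducible representation of `G × H` has the dimension of an external tensor product of
irreducible representations. -/
theorem IsIrreducible.exists_externalTensor.{u} {U : Type u} [AddCommGroup U] [Module k U]
    [Finite G] [Finite H]
    [CharZero k] [IsAlgClosed k] [FiniteDimensional k U] {τ : Representation k (G × H) U}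
    (hτ : τ.IsIrreducible) :
    ∃ (W N : Type u) (_ : AddCommGroup W) (_ : Module k W) (_ : FiniteDimensional k W)
      (_ : AddCommGroup N) (_ : Module k N) (_ : FiniteDimensional k N)
      (ρ : Representation k G W) (σ : Representation k H N),
      ρ.IsIrreducible ∧ σ.IsIrreducible ∧ finrank k U = finrank k W * finrank k N := by
  have hU := (isIrreducible_iff_forall.1 hτ).1
  let τG : Representation k G U := τ.comp (MonoidHom.inl G H)
  let τH : Representation k H U := τ.comp (MonoidHom.inr G H)
  have hτGH : ∀ g h u, τ (g, h) u = τH h (τG g u) := fun g h u => by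
    change _ = τ _ (τ _ u)
    rw [← Module.End.mul_apply, ← map_mul]
    simp
  have hτHG : ∀ g h u, τ (g, h) u = τG g (τH h u) := fun g h u => by
    change _ = τ _ (τ _ u)
    rw [← Module.End.mul_apply, ← map_mul]
    simp
  obtain ⟨W, hW⟩ := exists_isAtom τG
  -- `H` acts on linear maps `W → U` by postcomposition. The intertwiners `M` form an `H`-stable
  -- subspace because the two actions commute; evaluation pairs `W` with a constituent `N` of `M`
  -- equivariantly into `U`.
  let L : Representation k H (W.toSubmodule →ₗ[k] U) :=
    { toFun := fun h => LinearMap.compRight k (τH h)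
      map_one' := by ext; simp
      map_mul' := fun a b => by ext; simp }
  let M : Subrepresentation L :=
    { toSubmodule :=
        { carrier := {f | ∀ g w, f (W.toRepresentation g w) = τG g (f w)}
          zero_mem' := fun g w => by simp
          add_mem' := fun ha hb g w => by simp [ha g w, hb g w]
          smul_mem' := fun c f hf g w => by simp [hf g w] }
      apply_mem_toSubmodule := fun h f hf g w => by
        change τH h (f _) = τG g (τH h (f w))
        rw [hf g w, ← hτGH, hτHG] }
  have hWirr := isIrreducible_toRepresentation_of_isAtom hW
  have hM : Nontrivial M.toSubmodule := by
    rw [Submodule.nontrivial_iff_ne_bot]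
    intro e
    have h0 : W.toSubmodule.subtype ∈ M.toSubmodule := fun g w => rfl
    rw [e, Submodule.mem_bot] at h0
    apply hW.1
    apply Subrepresentation.toSubmodule_injective
    rw [← Submodule.range_subtype W.toSubmodule, h0, LinearMap.range_zero]
    rfl
  obtain ⟨N, hN⟩ := exists_isAtom M.toRepresentation
  have hNirr := isIrreducible_toRepresentation_of_isAtom hN
  refine ⟨W.toSubmodule, N.toSubmodule, inferInstance, inferInstance, inferInstance,
    inferInstance, inferInstance, inferInstance, W.toRepresentation, N.toRepresentation,
    hWirr, hNirr, ?_⟩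
  refine hWirr.finrank_eq_mul hNirr hτ (M.toSubmodule.subtype ∘ₗ N.toSubmodule.subtype).flip
    (fun g h w f => ?_) fun e => ?_
  · change τH h (f.1.1 (W.toRepresentation g w)) = τ (g, h) (f.1.1 w)
    rw [f.1.2 g w, hτGH]
  · have hN' : Nontrivial N.toSubmodule := (isIrreducible_iff_forall.1 hNirr).1
    obtain ⟨f, hf⟩ := exists_ne (0 : N.toSubmodule)
    apply hf
    apply Subtype.ext
    apply Subtype.ext
    ext w
    exact LinearMap.congr_fun (LinearMap.congr_fun e w) f

end ExternalTensor

end Representation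

namespace CharDegree

theorem mem_cd_iff {G : Type*} [Group G] {d : ℕ} :
    d ∈ cd G ↔ ∃ (V : Type) (_ : AddCommGroup V) (_ : Module ℂ V) (_ : FiniteDimensional ℂ V)
      (ρ : Representation ℂ G V), ρ.IsIrreducible ∧ finrank ℂ V = d := by
  constructor
  · rintro ⟨_, ⟨V, _, _, _, ρ, hρ, rfl⟩, hd⟩
    rw [Representation.char_one] at hd
    exact ⟨V, _, _, inferInstance, ρ, hρ, by exact_mod_cast hd⟩
  · rintro ⟨V, _, _, _, ρ, hρ, rfl⟩
    exact ⟨_, ⟨V, _, _, inferInstance, ρ, hρ, rfl⟩, ρ.char_one⟩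

/-- Degrees of a direct product are the products of degrees of the factors. -/
theorem mem_cd_prod_iff {G H : Type*} [Group G] [Group H] [Finite G] [Finite H] {d : ℕ} :
    d ∈ cd (G × H) ↔ ∃ a ∈ cd G, ∃ b ∈ cd H, d = a * b := by
  constructor
  · intro hd
    obtain ⟨U, _, _, _, τ, hτ, rfl⟩ := mem_cd_iff.1 hd
    obtain ⟨W, N, _, _, _, _, _, _, ρ, σ, hρ, hσ, h⟩ := hτ.exists_externalTensor
    exact ⟨_, mem_cd_iff.2 ⟨W, _, _, inferInstance, ρ, hρ, rfl⟩, _,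
      mem_cd_iff.2 ⟨N, _, _, inferInstance, σ, hσ, rfl⟩, h⟩
  · rintro ⟨a, ha, b, hb, rfl⟩
    obtain ⟨V, _, _, _, ρ, hρ, rfl⟩ := mem_cd_iff.1 ha
    obtain ⟨W, _, _, _, σ, hσ, rfl⟩ := mem_cd_iff.1 hb
    exact mem_cd_iff.2 ⟨_, _, _, inferInstance, _, hρ.externalTensor hσ, finrank_tensorProduct ..⟩

end CharDegree

/-! ### Counting dimensions by eigenvectors; constituents of permutation representations -/

namespace Representation

variable {k G V : Type*} [Field k] [Group G] [AddCommGroup V] [Module k V]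

/-- If an irreducible representation is spanned by a family of vectors that the group permutes up
to scalars, and some group element has them as eigenvectors for distinct eigenvalues, then its
dimension is the size of the family. -/
theorem IsIrreducible.finrank_eq_card {ρ : Representation k G V} (hρ : ρ.IsIrreducible)
    {ι : Type*} [Finite ι] [Nonempty ι] (v : ι → V) (hv : ∀ i, v i ≠ 0)
    (hinv : ∀ g i, ∃ j, ∃ c : k, ρ g (v i) = c • v j) (g₀ : G) (μ : ι → k)
    (hμ : Function.Injective μ) (hg₀ : ∀ i, ρ g₀ (v i) = μ i • v i) :
    finrank k V = Nat.card ι := by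
  have := Fintype.ofFinite ι
  have hli : LinearIndependent k v :=
    Module.End.eigenvectors_linearIndependent' (ρ g₀) μ hμ v fun i =>
      ⟨Module.End.mem_eigenspace_iff.2 (hg₀ i), hv i⟩
  have hspan : Submodule.span k (Set.range v) = ⊤ := by
    refine ((isIrreducible_iff_forall.1 hρ).2 _ fun g w hw => ?_).resolve_left fun h => ?_
    · induction hw using Submodule.span_induction with
      | mem w hw =>
        obtain ⟨i, rfl⟩ := hw
        obtain ⟨j, c, h⟩ := hinv g i
        rw [h]
        exact Submodule.smul_mem _ _ (Submodule.subset_span ⟨j, rfl⟩)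
      | zero => rw [map_zero]; exact zero_mem _
      | add a b _ _ ha hb => rw [map_add]; exact add_mem ha hb
      | smul c a _ ha => rw [map_smul]; exact Submodule.smul_mem _ _ ha
    · obtain ⟨i⟩ := ‹Nonempty ι›
      exact hv i (Submodule.span_eq_bot.1 h _ ⟨i, rfl⟩)
  rw [finrank_eq_card_basis (Basis.mk hli hspan.ge), Nat.card_eq_fintype_card]

/-- The permutation representation on functions on a `G`-set. -/
def funAction (k : Type*) [Field k] (G X : Type*) [Group G] [MulAction G X] :
    Representation k G (X → k) where
  toFun g := LinearMap.funLeft k k (g⁻¹ • ·)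
  map_one' := by ext; simp
  map_mul' g h := by
    ext f
    simp [LinearMap.funLeft_apply, mul_smul]

theorem funAction_apply {X : Type*} [MulAction G X] (g : G) (f : X → k) (x : X) :
    funAction k G X g f x = f (g⁻¹ • x) :=
  rfl

/-- If `g` moves a point of a finite `G`-set, then some irreducible representation is nontrivial on
`g` and trivial on all elements that fix the `G`-set pointwise. -/
theorem exists_isIrreducible_of_smul_ne {X : Type} [MulAction G X] [Finite X] [Finite G]
    {g : G} {x : X} (hx : g • x ≠ x) :
    ∃ (V : Type) (_ : AddCommGroup V) (_ : Module ℂ V) (_ : FiniteDimensional ℂ V)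
      (ρ : Representation ℂ G V), ρ.IsIrreducible ∧ ρ g ≠ 1 ∧
        ∀ h : G, (∀ y : X, h • y = y) → ρ h = 1 := by
  classical
  have hg : funAction ℂ G X g ≠ 1 := by
    intro h
    have h1 := congrFun (LinearMap.congr_fun h (Pi.single x 1)) (g • x)
    rw [funAction_apply, inv_smul_smul] at h1
    simp [hx] at h1
  obtain ⟨σ, hσ, v, hv, hgv⟩ := exists_isAtom_apply_ne _ g hg
  refine ⟨σ.toSubmodule, inferInstance, inferInstance, inferInstance, σ.toRepresentation,
    isIrreducible_toRepresentation_of_isAtom hσ, fun h => hgv ?_, fun h hh => ?_⟩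
  · exact congrArg Subtype.val (LinearMap.congr_fun h ⟨v, hv⟩)
  · ext w y
    change funAction ℂ G X h w.1 y = w.1 y
    rw [funAction_apply, inv_smul_eq_iff.2 (hh y).symm]

theorem exists_addChar_eigenvector {A B V : Type*} [AddCommGroup A] [AddCommGroup B] [Finite A]
    [Finite B] [AddCommGroup V] [Module ℂ V] [FiniteDimensional ℂ V] [Nontrivial V]
    (ρ : Representation ℂ (Multiplicative (A × B)) V) :
    ∃ v : V, v ≠ 0 ∧ ∃ (α : AddChar A ℂ) (β : AddChar B ℂ),
      ∀ a b, ρ (Multiplicative.ofAdd (a, b)) v = (α a * β b) • v := by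
  obtain ⟨v, hv, χ, hχ⟩ := exists_eigenvector ρ
  let ψ : AddChar (A × B) ℂ := AddChar.toMonoidHomEquiv.symm χ
  refine ⟨v, hv, ψ.compAddMonoidHom (AddMonoidHom.inl A B),
    ψ.compAddMonoidHom (AddMonoidHom.inr A B), fun a b => ?_⟩
  rw [hχ, AddChar.compAddMonoidHom_apply, AddChar.compAddMonoidHom_apply,
    ← AddChar.map_add_eq_mul]
  simp [ψ]

theorem isIrreducible_trivial : (trivial k G k).IsIrreducible := by
  rw [isIrreducible_iff_forall]
  exact ⟨inferInstance, fun U _ => eq_bot_or_eq_top U⟩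

end Representation

/-! ### Additive characters of a prime field -/

/-- An additive character of a prime field that is not trivial is injective. -/
theorem AddChar.injective_of_ne_one_zmod {p : ℕ} [Fact p.Prime] {M : Type*} [CommMonoid M]
    {ψ : AddChar (ZMod p) M} (hψ : ψ ≠ 1) : Function.Injective ψ := by
  intro a b hab
  by_contra hne
  have hd : ψ (a - b) = 1 := by
    rw [sub_eq_add_neg, AddChar.map_add_eq_mul, hab, ← AddChar.map_add_eq_mul, add_neg_cancel,
      AddChar.map_zero_eq_one]
  have hd0 : a - b ≠ 0 := sub_ne_zero.2 hne
  apply hψ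
  rw [AddChar.eq_one_iff]
  intro t
  have : t = (t / (a - b)).val • (a - b) := by
    rw [nsmul_eq_mul, ZMod.natCast_zmod_val, div_mul_cancel₀ _ hd0]
  rw [this, AddChar.map_nsmul_eq_pow, hd, one_pow]

/-- The shifts of a nontrivial `ψ` are distinct and there are `p` of them, as many as there are
characters. -/
theorem AddChar.exists_eq_mulShift {p : ℕ} [Fact p.Prime] {ψ : AddChar (ZMod p) ℂ} (hψ : ψ ≠ 1)
    (φ : AddChar (ZMod p) ℂ) : ∃ c, ∀ y, φ y = ψ (c * y) := by
  have hinj : Function.Injective ψ.mulShift :=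
    AddChar.to_mulShift_inj_of_isPrimitive (AddChar.IsPrimitive.of_ne_one hψ)
  have hsurj := ((Fintype.bijective_iff_injective_and_card _).2
    ⟨hinj, (AddChar.card_eq (α := ZMod p)).symm⟩).2
  obtain ⟨c, rfl⟩ := hsurj φ
  exact ⟨c, fun y => AddChar.mulShift_apply⟩

/-! ### The Heisenberg group extended by a torus -/

/-- The semidirect product of the Heisenberg group over `F` with a group `C` of scalars: `a ∈ C`
acts on the Heisenberg group by `(x, y, z) ↦ (a x, a⁻¹ y, z)`. -/
@[ext]
structure HeisenbergTorus (F : Type*) [Field F] (C : Subgroup Fˣ) where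
  x : F
  y : F
  z : F
  a : C

namespace HeisenbergTorus

section Group

variable {F : Type*} [Field F] {C : Subgroup Fˣ}

instance : Mul (HeisenbergTorus F C) where
  mul g h := ⟨g.x + g.a.1.1 * h.x, g.y + g.a.1.1⁻¹ * h.y,
    g.z + h.z + g.x * (g.a.1.1⁻¹ * h.y), g.a * h.a⟩

instance : One (HeisenbergTorus F C) where
  one := ⟨0, 0, 0, 1⟩

instance : Inv (HeisenbergTorus F C) where
  inv g := ⟨-(g.a.1.1⁻¹ * g.x), -(g.a.1.1 * g.y), -g.z + g.x * g.y, g.a⁻¹⟩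

theorem mk_mul_mk (x y z x' y' z' : F) (a a' : C) :
    (⟨x, y, z, a⟩ * ⟨x', y', z', a'⟩ : HeisenbergTorus F C) =
      ⟨x + a.1.1 * x', y + a.1.1⁻¹ * y', z + z' + x * (a.1.1⁻¹ * y'), a * a'⟩ :=
  rfl

theorem one_def : (1 : HeisenbergTorus F C) = ⟨0, 0, 0, 1⟩ :=
  rfl

theorem inv_mk (x y z : F) (a : C) : (⟨x, y, z, a⟩⁻¹ : HeisenbergTorus F C) =
    ⟨-(a.1.1⁻¹ * x), -(a.1.1 * y), -z + x * y, a⁻¹⟩ :=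
  rfl

instance : Group (HeisenbergTorus F C) :=
  Group.ofLeftAxioms
    (by
      rintro ⟨x, y, z, a⟩ ⟨x', y', z', a'⟩ ⟨x'', y'', z'', a''⟩
      simp only [mk_mul_mk, mk.injEq]
      refine ⟨?_, ?_, ?_, mul_assoc _ _ _⟩
      · push_cast; ring
      · push_cast; ring
      · push_cast
        have := a.1.ne_zero
        have := a'.1.ne_zero
        field_simp
        ring)
    (by
      rintro ⟨x, y, z, a⟩
      simp [one_def, mk_mul_mk])
    (by
      rintro ⟨x, y, z, a⟩
      have := a.1.ne_zero
      simp only [one_def, mk_mul_mk, inv_mk, mk.injEq]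
      refine ⟨by simp, by simp, ?_, by simp⟩
      push_cast
      field_simp
      ring)

instance [Finite F] : Finite (HeisenbergTorus F C) :=
  Finite.of_injective (fun g => (g.x, g.y, g.z, g.a)) fun g h e => by
    simp only [Prod.mk.injEq] at e
    exact HeisenbergTorus.ext e.1 e.2.1 e.2.2.1 e.2.2.2

/-- The projection to the torus. -/
def toTorus : HeisenbergTorus F C →* C where
  toFun := a
  map_one' := rfl
  map_mul' _ _ := rfl

/-- The inclusion of the torus. -/
def ofTorus : C →* HeisenbergTorus F C where
  toFun a := ⟨0, 0, 0, a⟩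
  map_one' := rfl
  map_mul' a b := by simp [mk_mul_mk]

/-- The inclusion of a maximal abelian subgroup of the Heisenberg group. -/
def ofYZ : Multiplicative (F × F) →* HeisenbergTorus F C where
  toFun u := ⟨0, u.toAdd.1, u.toAdd.2, 1⟩
  map_one' := rfl
  map_mul' u v := by simp [mk_mul_mk]

/-- The abelianization of the Heisenberg group. -/
def kerToXY : (toTorus (F := F) (C := C)).ker →* Multiplicative (F × F) where
  toFun g := Multiplicative.ofAdd (g.1.x, g.1.y)
  map_one' := rfl
  map_mul' := by
    rintro ⟨⟨x, y, z, a⟩, ha⟩ ⟨⟨x', y', z', a'⟩, ha'⟩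
    obtain rfl : a = 1 := ha
    simp [mk_mul_mk, ← ofAdd_add]

/-- Peel off the torus, then the coordinates `(x, y)`; what remains is the commutative group of the
`z`. -/
instance : Group.IsSolvable (HeisenbergTorus F C) := by
  have h1 : Group.IsSolvable (kerToXY (F := F) (C := C)).ker := by
    apply Group.isSolvable_of_comm
    rintro ⟨⟨⟨x, y, z, a⟩, ha⟩, hx⟩ ⟨⟨⟨x', y', z', a'⟩, ha'⟩, hx'⟩
    obtain rfl : a = 1 := ha
    obtain rfl : a' = 1 := ha'
    obtain ⟨rfl, rfl⟩ : x = 0 ∧ y = 0 := Prod.mk.inj hx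
    obtain ⟨rfl, rfl⟩ : x' = 0 ∧ y' = 0 := Prod.mk.inj hx'
    apply Subtype.ext
    apply Subtype.ext
    simp [mk_mul_mk, add_comm]
  have h2 : Group.IsSolvable (toTorus (F := F) (C := C)).ker :=
    Group.isSolvable_of_ker_le_range kerToXY.ker.subtype kerToXY (Subgroup.range_subtype _).ge
  exact Group.isSolvable_of_ker_le_range toTorus.ker.subtype toTorus (Subgroup.range_subtype _).ge

/-- The affine action on the first coordinate. -/
@[reducible]
def affineAction : MulAction (HeisenbergTorus F C) F where
  smul g t := g.x + g.a.1.1 * t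
  one_smul t := by change 0 + (1 : C).1.1 * t = t; simp
  mul_smul g h t := by
    change (g.x + g.a.1.1 * h.x) + (g.a * h.a).1.1 * t = g.x + g.a.1.1 * (h.x + h.a.1.1 * t)
    push_cast
    ring

/-- This and the next identities move factors past each other so that those left on the right act on
a chosen eigenvector by known scalars, or fix a subspace whose invariance is to be shown. -/
theorem mk_mul_ofTorus (x y z : F) (a b : C) :
    (⟨x, y, z, b⟩ * ⟨0, 0, 0, a⟩ : HeisenbergTorus F C) =
      ⟨0, 0, 0, b * a⟩ * ⟨(b * a).1.1⁻¹ * x, (b * a).1.1 * y, z, 1⟩ := by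
  simp only [mk_mul_mk, mul_zero, add_zero, zero_add, zero_mul, mul_one, mk.injEq]
  have := (b * a).1.ne_zero
  exact ⟨by field_simp, by field_simp, trivial, trivial⟩

theorem heisenberg_mul_mk (x' y' z' x y z : F) (a : C) :
    (⟨x', y', z', 1⟩ * ⟨x, y, z, a⟩ : HeisenbergTorus F C) =
      ⟨x, y, z, a⟩ * ⟨a.1.1⁻¹ * x', a.1.1 * y', z' + x' * y - x * y', 1⟩ := by
  have := a.1.ne_zero
  simp only [mk_mul_mk, mk.injEq, Subgroup.coe_one, Units.val_one, one_mul, inv_one, mul_one,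
    and_true]
  exact ⟨by field_simp; ring, by field_simp; ring, by field_simp; ring⟩

theorem mk_mul_ofX (x y z t : F) (a : C) :
    (⟨x, y, z, a⟩ * ⟨t, 0, 0, 1⟩ : HeisenbergTorus F C) =
      ⟨x + a.1.1 * t, 0, 0, 1⟩ * (⟨0, y, z - (x + a.1.1 * t) * y, 1⟩ * ⟨0, 0, 0, a⟩) := by
  simp only [mk_mul_mk, mk.injEq, Subgroup.coe_one, Units.val_one, one_mul, inv_one, mul_one,
    mul_zero, add_zero, zero_add, true_and, and_true]
  ring

theorem ofYZ_mul_ofX (y z t : F) :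
    (⟨0, y, z, 1⟩ * ⟨t, 0, 0, 1⟩ : HeisenbergTorus F C) =
      ⟨t, 0, 0, 1⟩ * ⟨0, y, z - t * y, 1⟩ := by
  simp only [mk_mul_mk, mk.injEq, Subgroup.coe_one, Units.val_one, one_mul, inv_one, mul_one,
    mul_zero, add_zero, zero_add, true_and, and_true]
  ring

theorem ofYZ_mul_ofTorus (y z : F) (a : C) :
    (⟨0, y, z, 1⟩ * ⟨0, 0, 0, a⟩ : HeisenbergTorus F C) =
      ⟨0, 0, 0, a⟩ * ⟨0, a.1.1 * y, z, 1⟩ := by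
  have := mk_mul_ofTorus 0 y z a 1
  rwa [one_mul, mul_zero] at this

end Group

end HeisenbergTorus

namespace HeisenbergTorus

/-! ### The three possible degrees -/

open Representation

section Degrees

variable {p : ℕ} [Fact p.Prime] {C : Subgroup (ZMod p)ˣ} {V : Type*} [AddCommGroup V] [Module ℂ V]
  [FiniteDimensional ℂ V] {ρ : Representation ℂ (HeisenbergTorus (ZMod p) C) V}

/-- An irreducible representation on which the centre of the Heisenberg group acts nontrivially has
dimension `p`. -/
theorem finrank_eq_of_center_ne (hρ : ρ.IsIrreducible)
    (hZ : ¬ ∀ z : ZMod p, ρ ⟨0, 0, z, 1⟩ = 1) : finrank ℂ V = p := by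
  have hV := (isIrreducible_iff_forall.1 hρ).1
  obtain ⟨v, hv, lam, ζ, hlam⟩ := exists_addChar_eigenvector
    (ρ.comp ofYZ : Representation ℂ (Multiplicative (ZMod p × ZMod p)) V)
  replace hlam : ∀ y z, ρ ⟨0, y, z, 1⟩ v = (lam y * ζ z) • v := hlam
  -- The vectors fixed by the centre form an invariant subspace; were `ζ` trivial, it would contain
  -- `v` and be everything.
  have hζ : ζ ≠ 1 := by
    intro hζ
    have hor := (isIrreducible_iff_forall.1 hρ).2
      (⨅ z : ZMod p, LinearMap.ker (ρ ⟨0, 0, z, 1⟩ - 1)) (by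
        rintro ⟨x, y, z, a⟩ w hw
        simp only [Submodule.mem_iInf, LinearMap.mem_ker, LinearMap.sub_apply,
          Module.End.one_apply, sub_eq_zero] at hw ⊢
        intro z'
        have h := heisenberg_mul_mk 0 0 z' x y z a
        rw [mul_zero, mul_zero, mul_zero, zero_mul, add_zero, sub_zero] at h
        rw [← Module.End.mul_apply, ← map_mul, h, map_mul, Module.End.mul_apply, hw])
    rcases hor with h | h
    · have : v ∈ (⊥ : Submodule ℂ V) := by
        rw [← h]
        simp [Submodule.mem_iInf, hlam, hζ]
      exact hv this
    · apply hZ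
      intro z
      rw [← sub_eq_zero, ← LinearMap.ker_eq_top, eq_top_iff, ← h]
      exact iInf_le _ z
  -- Translating `v` by `x = c` multiplies its `y`-character by `ζ (-c * y)`, cancelling `lam`. So
  -- the space `U` where `y` acts trivially and `z` by `ζ` is nonzero; the torus preserves it and
  -- has an eigenvector `u` there.
  obtain ⟨c, hc⟩ := AddChar.exists_eq_mulShift hζ lam
  let U : Subrepresentation (ρ.comp ofTorus : Representation ℂ C V) :=
    { toSubmodule := ⨅ y : ZMod p, ⨅ z : ZMod p, LinearMap.ker (ρ ⟨0, y, z, 1⟩ - ζ z • 1)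
      apply_mem_toSubmodule := by
        intro a w hw
        simp only [Submodule.mem_iInf, LinearMap.mem_ker, LinearMap.sub_apply,
          LinearMap.smul_apply, Module.End.one_apply, sub_eq_zero] at hw ⊢
        intro y z
        change ρ _ (ρ ⟨0, 0, 0, a⟩ w) = ζ z • ρ ⟨0, 0, 0, a⟩ w
        rw [← Module.End.mul_apply, ← map_mul, ofYZ_mul_ofTorus, map_mul, Module.End.mul_apply, hw,
          map_smul] }
  have hmemU : ∀ w, w ∈ U.toSubmodule ↔ ∀ y z, ρ ⟨0, y, z, 1⟩ w = ζ z • w := fun w => by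
    simp only [U, Submodule.mem_iInf, LinearMap.mem_ker, LinearMap.sub_apply,
      LinearMap.smul_apply, Module.End.one_apply, sub_eq_zero]
  have hinj : ∀ g w, w ≠ 0 → ρ g w ≠ 0 := fun g w hw h => hw <| by
    apply (ρ.apply_bijective g).1
    rw [h, map_zero]
  have hU : Nontrivial U.toSubmodule := by
    rw [Submodule.nontrivial_iff_ne_bot, Submodule.ne_bot_iff]
    refine ⟨ρ ⟨c, 0, 0, 1⟩ v, (hmemU _).2 fun y z => ?_, hinj _ _ hv⟩
    rw [← Module.End.mul_apply, ← map_mul, ofYZ_mul_ofX, map_mul, Module.End.mul_apply, hlam,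
      map_smul, hc, ← AddChar.map_add_eq_mul, add_sub_cancel]
  obtain ⟨⟨u, huU⟩, hu, θ, hθ⟩ := exists_eigenvector U.toRepresentation
  have hu0 : u ≠ 0 := fun h => hu (Subtype.ext h)
  replace hθ : ∀ a, ρ ⟨0, 0, 0, a⟩ u = θ a • u := fun a => congrArg Subtype.val (hθ a)
  rw [hmemU] at huU
  -- The `p` translates of `u` are permuted up to scalars, and the element with `y = 1` has the
  -- distinct eigenvalues `ζ (-t)` on them.
  have hcard := hρ.finrank_eq_card (fun t : ZMod p => ρ ⟨t, 0, 0, 1⟩ u) (fun t => hinj _ _ hu0)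
    (fun g t => ?_) ⟨0, 1, 0, 1⟩ (fun t => ζ (-t)) (fun s t h => ?_) fun t => ?_
  · rw [hcard, Nat.card_zmod]
  · obtain ⟨x, y, z, a⟩ := g
    refine ⟨x + a.1.1 * t, θ a * ζ (z - (x + a.1.1 * t) * y), ?_⟩
    rw [← Module.End.mul_apply, ← map_mul, mk_mul_ofX, map_mul, map_mul, Module.End.mul_apply,
      Module.End.mul_apply, hθ, map_smul, huU, smul_smul, map_smul]
  · exact neg_injective (AddChar.injective_of_ne_one_zmod hζ h)
  · rw [← Module.End.mul_apply, ← map_mul, ofYZ_mul_ofX, map_mul, Module.End.mul_apply, huU,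
      map_smul, mul_one, zero_sub]

/-- An irreducible representation on which the Heisenberg group acts nontrivially, but its centre
trivially, has the order of the torus as its dimension. -/
theorem finrank_eq_card_of_center_eq (hρ : ρ.IsIrreducible)
    (hZ : ∀ z : ZMod p, ρ ⟨0, 0, z, 1⟩ = 1) (hP : ¬ ∀ x y z : ZMod p, ρ ⟨x, y, z, 1⟩ = 1) :
    finrank ℂ V = Nat.card C := by
  have hV := (isIrreducible_iff_forall.1 hρ).1
  have hZ' : ∀ x y z : ZMod p, ρ ⟨x, y, z, 1⟩ = ρ ⟨x, y, 0, 1⟩ := fun x y z => by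
    have h : (⟨x, y, z, 1⟩ : HeisenbergTorus (ZMod p) C) = ⟨x, y, 0, 1⟩ * ⟨0, 0, z, 1⟩ := by
      simp [mk_mul_mk]
    rw [h, map_mul, hZ, mul_one]
  -- With the centre acting trivially, the Heisenberg group acts through the commutative group of
  -- pairs `(x, y)`.
  let τ : Representation ℂ (Multiplicative (ZMod p × ZMod p)) V :=
    { toFun := fun u => ρ ⟨u.toAdd.1, u.toAdd.2, 0, 1⟩
      map_one' := map_one ρ
      map_mul' := fun u v => by
        rw [← map_mul, mk_mul_mk, mul_one (1 : C), hZ' (u.toAdd.1 + _)]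
        simp }
  obtain ⟨v, hv, α, β, hαβ⟩ := exists_addChar_eigenvector τ
  have hχ : ∀ x y z, ρ ⟨x, y, z, 1⟩ v = (α x * β y) • v := fun x y z => by
    rw [hZ' x y z]
    exact hαβ x y
  have hv0 : ∀ a : C, ρ ⟨0, 0, 0, a⟩ v ≠ 0 := fun a h => hv <| by
    apply (ρ.apply_bijective ⟨0, 0, 0, a⟩).1
    rw [h, map_zero]
  have hact : ∀ x y z (a b : C), ρ ⟨x, y, z, b⟩ (ρ ⟨0, 0, 0, a⟩ v) =
      (α ((b * a).1.1⁻¹ * x) * β ((b * a).1.1 * y)) • ρ ⟨0, 0, 0, b * a⟩ v := fun x y z a b => by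
    rw [← map_smul, ← hχ _ _ z, ← Module.End.mul_apply, ← Module.End.mul_apply, ← map_mul,
      ← map_mul, mk_mul_ofTorus]
  have hinv : ∀ g (a : C), ∃ b : C, ∃ c : ℂ, ρ g (ρ ⟨0, 0, 0, a⟩ v) = c • ρ ⟨0, 0, 0, b⟩ v :=
    fun g a => ⟨_, _, hact g.x g.y g.z a g.a⟩
  -- The torus translates of `v` are separated by `x = 1` if `α` is nontrivial, and by `y = 1`
  -- otherwise.
  by_cases hα : α = 1
  · have hβ : β ≠ 1 := by
      intro hβ
      have hor := (isIrreducible_iff_forall.1 hρ).2 (⨅ x : ZMod p, ⨅ y : ZMod p, ⨅ z : ZMod p,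
        LinearMap.ker (ρ ⟨x, y, z, 1⟩ - 1)) (by
          rintro ⟨x, y, z, a⟩ w hw
          simp only [Submodule.mem_iInf, LinearMap.mem_ker, LinearMap.sub_apply,
            Module.End.one_apply, sub_eq_zero] at hw ⊢
          intro x' y' z'
          rw [← Module.End.mul_apply, ← map_mul, heisenberg_mul_mk, map_mul, Module.End.mul_apply, hw])
      rcases hor with h | h
      · have : v ∈ (⊥ : Submodule ℂ V) := by
          rw [← h]
          simp [Submodule.mem_iInf, hχ, hα, hβ]
        exact hv this
      · apply hP
        intro x y z
        rw [← sub_eq_zero, ← LinearMap.ker_eq_top, eq_top_iff, ← h]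
        exact (iInf_le _ x).trans ((iInf_le _ y).trans (iInf_le _ z))
    refine hρ.finrank_eq_card (fun a : C => ρ ⟨0, 0, 0, a⟩ v) hv0 hinv ⟨0, 1, 0, 1⟩
      (fun a => β a.1.1) (fun a b h => ?_) fun a => ?_
    · exact Subtype.ext (Units.ext (AddChar.injective_of_ne_one_zmod hβ h))
    · simp only [hact]
      simp only [one_mul, mul_one, mul_zero, AddChar.map_zero_eq_one]
  · refine hρ.finrank_eq_card (fun a : C => ρ ⟨0, 0, 0, a⟩ v) hv0 hinv ⟨1, 0, 0, 1⟩
      (fun a => α a.1.1⁻¹) (fun a b h => ?_) fun a => ?_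
    · exact Subtype.ext (Units.ext (inv_injective (AddChar.injective_of_ne_one_zmod hα h)))
    · simp only [hact]
      simp only [one_mul, mul_one, mul_zero, AddChar.map_zero_eq_one]

/-- An irreducible representation on which the Heisenberg group acts trivially is
one-dimensional. -/
theorem finrank_eq_one (hρ : ρ.IsIrreducible)
    (hP : ∀ x y z : ZMod p, ρ ⟨x, y, z, 1⟩ = 1) : finrank ℂ V = 1 := by
  have h : ∀ x y z a, ρ ⟨x, y, z, a⟩ = ρ (ofTorus a) := fun x y z a => by
    have h : (⟨x, y, z, a⟩ : HeisenbergTorus (ZMod p) C) = ⟨x, y, z, 1⟩ * ofTorus a := by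
      simp [mk_mul_mk, ofTorus]
    rw [h, map_mul, hP, one_mul]
  have hirr : IsIrreducible (ρ.comp ofTorus : Representation ℂ C V) := by
    rw [isIrreducible_iff_forall] at hρ ⊢
    refine ⟨hρ.1, fun U hU => hρ.2 U fun g v hv => ?_⟩
    obtain ⟨x, y, z, a⟩ := g
    rw [h]
    exact hU a v hv
  exact IsIrreducible.finrank_eq_one_of_isMulCommutative (ρ.comp ofTorus : Representation ℂ C V)

end Degrees

end HeisenbergTorus

/-! ### Realising the degrees and choosing the primes -/

namespace CharDegree

theorem one_mem_cd {G : Type*} [Group G] : 1 ∈ cd G :=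
  mem_cd_iff.2 ⟨ℂ, _, _, inferInstance, _, Representation.isIrreducible_trivial, finrank_self ℂ⟩

theorem mem_cd_heisenbergTorus {p : ℕ} [Fact p.Prime] {C : Subgroup (ZMod p)ˣ} {d : ℕ} :
    d ∈ cd (HeisenbergTorus (ZMod p) C) ↔ d = 1 ∨ d = Nat.card C ∨ d = p := by
  constructor
  · intro hd
    obtain ⟨V, _, _, _, ρ, hρ, rfl⟩ := mem_cd_iff.1 hd
    by_cases hZ : ∀ z : ZMod p, ρ ⟨0, 0, z, 1⟩ = 1
    · by_cases hP : ∀ x y z : ZMod p, ρ ⟨x, y, z, 1⟩ = 1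
      · exact Or.inl (HeisenbergTorus.finrank_eq_one hρ hP)
      · exact Or.inr (Or.inl (HeisenbergTorus.finrank_eq_card_of_center_eq hρ hZ hP))
    · exact Or.inr (Or.inr (HeisenbergTorus.finrank_eq_of_center_ne hρ hZ))
  · rintro (rfl | rfl | rfl)
    · exact one_mem_cd
    · let _ := HeisenbergTorus.affineAction (F := ZMod p) (C := C)
      have hsmul : ∀ (g : HeisenbergTorus (ZMod p) C) (t : ZMod p), g • t = g.x + g.a.1.1 * t :=
        fun _ _ => rfl
      have hne : (⟨1, 0, 0, 1⟩ : HeisenbergTorus (ZMod p) C) • (0 : ZMod p) ≠ 0 := by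
        rw [hsmul, mul_zero, add_zero]
        exact one_ne_zero
      obtain ⟨V, _, _, _, ρ, hρ, h1, h2⟩ := Representation.exists_isIrreducible_of_smul_ne hne
      refine mem_cd_iff.2 ⟨V, _, _, inferInstance, ρ, hρ,
        HeisenbergTorus.finrank_eq_card_of_center_eq hρ (fun z => h2 _ fun t => ?_)
          fun h => h1 (h 1 0 0)⟩
      rw [hsmul, Subgroup.coe_one, Units.val_one, one_mul, zero_add]
    · have hne : (⟨0, 0, 1, 1⟩ : HeisenbergTorus (ZMod d) C) •
          (1 : HeisenbergTorus (ZMod d) C) ≠ 1 := by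
        rw [smul_eq_mul, mul_one]
        exact fun h => one_ne_zero (congrArg HeisenbergTorus.z h)
      obtain ⟨V, _, _, _, ρ, hρ, h1, -⟩ := Representation.exists_isIrreducible_of_smul_ne hne
      exact mem_cd_iff.2 ⟨V, _, _, inferInstance, ρ, hρ,
        HeisenbergTorus.finrank_eq_of_center_ne hρ fun h => h1 (h 1)⟩

/-- For primes `r ∣ p - 1` there is a finite solvable group with character degrees `1`, `r`, `p`. -/
theorem exists_cd_eq {p r : ℕ} (hp : p.Prime) (hr : r.Prime) (hpr : p ≡ 1 [MOD r]) :
    ∃ (G : Type) (_ : Group G) (_ : Finite G),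
      Group.IsSolvable G ∧ ∀ d, d ∈ cd G ↔ d = 1 ∨ d = r ∨ d = p := by
  have := Fact.mk hp
  have := Fact.mk hr
  have hdvd : r ∣ Nat.card (ZMod p)ˣ := by
    rw [Nat.card_eq_fintype_card, ZMod.card_units]
    exact (Nat.modEq_iff_dvd' hp.one_le).1 hpr.symm
  obtain ⟨u, hu⟩ := exists_prime_orderOf_dvd_card' r hdvd
  refine ⟨HeisenbergTorus (ZMod p) (Subgroup.zpowers u), inferInstance, inferInstance,
    inferInstance, fun d => ?_⟩
  rw [mem_cd_heisenbergTorus, Nat.card_zpowers, hu]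

/-- The degrees of a direct product of groups with character degrees `1`, `r i`, `p i`. -/
theorem exists_cd_eq_prod (p r : ℕ → ℕ) (hp : ∀ i, (p i).Prime) (hr : ∀ i, (r i).Prime)
    (hpr : ∀ i, p i ≡ 1 [MOD r i]) (k : ℕ) :
    ∃ (G : Type) (_ : Group G) (_ : Finite G), Group.IsSolvable G ∧
      ∀ d, d ∈ cd G ↔ ∃ f : ℕ → ℕ, (∀ i, f i = 1 ∨ f i = r i ∨ f i = p i) ∧
        d = ∏ i ∈ Finset.range k, f i := by
  induction k with
  | zero =>
    refine ⟨Unit, inferInstance, inferInstance, inferInstance, fun d => ?_⟩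
    simp only [Finset.range_zero, Finset.prod_empty]
    constructor
    · intro hd
      obtain ⟨V, _, _, _, ρ, hρ, rfl⟩ := mem_cd_iff.1 hd
      exact ⟨1, fun i => Or.inl rfl,
        Representation.IsIrreducible.finrank_eq_one_of_isMulCommutative ρ⟩
    · rintro ⟨-, -, rfl⟩
      exact one_mem_cd
  | succ k ih =>
    obtain ⟨G, _, _, hG, hcd⟩ := ih
    obtain ⟨H, _, _, hH, hcdH⟩ := exists_cd_eq (hp k) (hr k) (hpr k)
    refine ⟨G × H, inferInstance, inferInstance, inferInstance, fun d => ?_⟩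
    rw [mem_cd_prod_iff]
    constructor
    · rintro ⟨a, ha, b, hb, rfl⟩
      obtain ⟨f, hf, rfl⟩ := (hcd a).1 ha
      rw [hcdH] at hb
      -- Only the values of `f` below `k` enter the earlier product, so its value at `k` is free.
      refine ⟨Function.update f k b, fun i => ?_, ?_⟩
      · by_cases hi : i = k
        · subst hi
          simpa using hb
        · simpa [hi] using hf i
      · rw [Finset.prod_range_succ, Function.update_self]
        congr 1
        refine Finset.prod_congr rfl fun i hi => ?_
        rw [Function.update_of_ne (Finset.mem_range.1 hi).ne]
    · rintro ⟨f, hf, rfl⟩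
      exact ⟨_, (hcd _).2 ⟨f, hf, rfl⟩, f k, (hcdH _).2 (hf k), Finset.prod_range_succ ..⟩

/-- There are arbitrarily many pairs of primes `p ≡ 1 (mod r)`, all distinct. Here the primes
`q (2 * i)` and `q (2 * i + 1)` form a pair. -/
theorem exists_strictMono_primes : ∃ q : ℕ → ℕ, StrictMono q ∧ (∀ i, (q i).Prime) ∧
    ∀ i, q (2 * i + 1) ≡ 1 [MOD q (2 * i)] := by
  have h : ∀ m : ℕ, ∃ s : ℕ × ℕ, m < s.1 ∧ s.1 < s.2 ∧ s.1.Prime ∧ s.2.Prime ∧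
      s.2 ≡ 1 [MOD s.1] := fun m => by
    obtain ⟨r, hmr, hr⟩ := Nat.exists_infinite_primes (m + 1)
    obtain ⟨p, hp, hrp, hpr⟩ := Nat.exists_prime_gt_modEq_one r hr.ne_zero
    exact ⟨(r, p), by simpa using hmr, hrp, hr, hp, hpr⟩
  choose s h1 h2 h3 h4 h5 using h
  -- Each new pair starts above the larger prime of the previous one.
  let t : ℕ → ℕ × ℕ := fun n => Nat.rec (s 0) (fun _ u => s u.2) n
  have ht : ∀ n, ∃ m, t n = s m := fun n => by
    cases n with
    | zero => exact ⟨0, rfl⟩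
    | succ n => exact ⟨(t n).2, rfl⟩
  let q : ℕ → ℕ := fun n => if n % 2 = 0 then (t (n / 2)).1 else (t (n / 2)).2
  have hq0 : ∀ i, q (2 * i) = (t i).1 := fun i => by simp [q]
  have hq1 : ∀ i, q (2 * i + 1) = (t i).2 := fun i => by
    have : (2 * i + 1) / 2 = i := by omega
    simp [q, Nat.add_mod, this]
  refine ⟨q, strictMono_nat_of_lt_succ fun n => ?_, fun n => ?_, fun i => ?_⟩
  · obtain ⟨i, rfl | rfl⟩ := Nat.even_or_odd' n
    · rw [hq0, hq1]
      obtain ⟨m, hm⟩ := ht i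
      rw [hm]
      exact h2 m
    · rw [hq1, show 2 * i + 1 + 1 = 2 * (i + 1) by ring, hq0]
      exact h1 (t i).2
  · obtain ⟨i, rfl | rfl⟩ := Nat.even_or_odd' n
    · obtain ⟨m, hm⟩ := ht i
      rw [hq0, hm]
      exact h3 m
    · obtain ⟨m, hm⟩ := ht i
      rw [hq1, hm]
      exact h4 m
  · obtain ⟨m, hm⟩ := ht i
    rw [hq0, hq1, hm]
    exact h5 m

end CharDegree

/-! ### The complement as a perfect matching -/

/-- The vertices of a `(n - 2)`-regular graph on `n ≥ 2` vertices can be arranged in pairs such that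
two vertices are adjacent if and only if they lie in different pairs. -/
theorem SimpleGraph.IsRegularOfDegree.exists_equiv_prod_fin_two {V : Type*} [Fintype V]
    {Γ : SimpleGraph V} [DecidableRel Γ.Adj] (hV : 2 ≤ Fintype.card V)
    (hreg : Γ.IsRegularOfDegree (Fintype.card V - 2)) :
    ∃ (k : ℕ) (e : V ≃ Fin k × Fin 2), ∀ v w, Γ.Adj v w ↔ (e v).1 ≠ (e w).1 := by
  classical
  -- The complement has degree `1`, so its unique neighbour map `σ` is a fixed-point-free
  -- involution.
  have hσ : ∀ v, ∃! w, Γᶜ.Adj v w := fun v => by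
    rw [← SimpleGraph.degree_eq_one_iff_existsUnique_adj, hreg.compl v]
    omega
  choose σ hσadj hσuniq using hσ
  have hinv : ∀ v, σ (σ v) = v := fun v => (hσuniq _ _ (hσadj v).symm).symm
  have hadj : ∀ v w, ¬ Γ.Adj v w ↔ v = w ∨ v = σ w := fun v w => by
    constructor
    · intro h
      by_cases hvw : v = w
      · exact Or.inl hvw
      · right
        rw [← hσuniq w v ((SimpleGraph.compl_adj ..).2 ⟨fun e => hvw e.symm, fun e => h e.symm⟩)]
    · rintro (rfl | rfl)
      · exact Γ.irrefl
      · exact fun h => ((SimpleGraph.compl_adj ..).1 (hσadj w)).2 h.symm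
  have hne : ∀ v, v ≠ σ v := fun v => (hσadj v).ne
  -- An arbitrary ordering selects one representative from each pair `{v, σ v}`.
  let o := Fintype.equivFin V
  let T := {v : V // o v < o (σ v)}
  let g : T × Fin 2 → V := fun a => if a.2 = 0 then a.1.1 else σ a.1.1
  have hT : ∀ s t : T, s.1 ≠ σ t.1 := fun s t h => by
    have h1 := s.2
    have h2 := t.2
    rw [h, hinv] at h1
    exact lt_asymm h1 h2
  have hg : ∀ a b : T × Fin 2, (g a = g b ∨ g a = σ (g b)) ↔ a.1 = b.1 := by
    rintro ⟨s, i⟩ ⟨t, j⟩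
    have hst : (s.1 = t.1 ∨ s.1 = σ t.1) ↔ s = t :=
      ⟨fun h => Subtype.ext (h.resolve_right (hT s t)), fun h => Or.inl (congrArg _ h)⟩
    have hσst : σ s.1 = σ t.1 ↔ s.1 = t.1 := (Function.LeftInverse.injective hinv).eq_iff
    have hσst' : σ s.1 = t.1 ↔ s.1 = σ t.1 :=
      ⟨fun h => by rw [← h, hinv], fun h => by rw [h, hinv]⟩
    simp only [g]
    split_ifs
    · exact hst
    · rw [hinv, or_comm]; exact hst
    · rw [hσst, hσst', or_comm]; exact hst
    · rw [hσst, hinv, hσst']; exact hst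
  have hbij : Function.Bijective g := by
    constructor
    · rintro ⟨s, i⟩ ⟨t, j⟩ h
      obtain rfl : s = t := (hg (s, i) (t, j)).1 (Or.inl h)
      fin_cases i <;> fin_cases j <;> first | rfl | skip
      · exact absurd h (hne s.1)
      · exact absurd h.symm (hne s.1)
    · intro v
      rcases lt_or_gt_of_ne (fun h => hne v (o.injective h)) with h | h
      · exact ⟨(⟨v, h⟩, 0), rfl⟩
      · exact ⟨(⟨σ v, by rwa [hinv]⟩, 1), hinv v⟩
  let E := Equiv.ofBijective g hbij
  refine ⟨Fintype.card T, E.symm.trans ((Fintype.equivFin T).prodCongr (Equiv.refl _)), ?_⟩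
  intro v w
  obtain ⟨a, rfl⟩ := E.surjective v
  obtain ⟨b, rfl⟩ := E.surjective w
  rw [← not_iff_not, hadj, not_not]
  simp only [Equiv.trans_apply, Equiv.symm_apply_apply, Equiv.prodCongr_apply, Prod.map_fst,
    EmbeddingLike.apply_eq_iff_eq]
  rw [← hg a b, ← E.apply_eq_iff_eq]
  rfl

/-! ### Assembling the graph -/

namespace CharDegree

/-- There is a finite solvable group whose character degree graph is a complete multipartite graph
with `k` parts of size two. -/
theorem exists_degreeGraph_eq (k : ℕ) :
    ∃ (G : Type) (_ : Group G) (_ : Finite G), Group.IsSolvable G ∧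
      ∃ q : Fin k × Fin 2 → ℕ, Function.Injective q ∧ Set.range q = degreePrimes G ∧
        ∀ a b, a ≠ b → ((∃ d ∈ cd G, q a * q b ∣ d) ↔ a.1 ≠ b.1) := by
  obtain ⟨Q, hQ, hprime, hmod⟩ := exists_strictMono_primes
  obtain ⟨G, _, _, hG, hcd⟩ := exists_cd_eq_prod (fun i => Q (2 * i + 1)) (fun i => Q (2 * i))
    (fun i => hprime _) (fun i => hprime _) hmod k
  let q : Fin k × Fin 2 → ℕ := fun a => Q (2 * a.1 + a.2)
  have hq : Function.Injective q := by
    rintro ⟨a, i⟩ ⟨b, j⟩ h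
    have := hQ.injective h
    simp only at this
    refine Prod.ext (Fin.ext ?_) (Fin.ext ?_) <;> simp only <;> omega
  have hqp : ∀ a, (q a).Prime := fun a => hprime _
  -- A prime dividing a degree is the whole contribution of its factor; hence two primes of the same
  -- pair never divide one degree.
  have hval : ∀ {f : ℕ → ℕ}, (∀ i, f i = 1 ∨ f i = Q (2 * i) ∨ f i = Q (2 * i + 1)) →
      ∀ {π : ℕ}, π.Prime → π ∣ ∏ i ∈ Finset.range k, f i →
        ∃ a : Fin k × Fin 2, π = q a ∧ f a.1 = q a := by
    intro f hf π hπ hdvd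
    obtain ⟨i, hi, hdvd⟩ := (Prime.dvd_finsetProd_iff hπ.prime f).1 hdvd
    rw [Finset.mem_range] at hi
    rcases hf i with h | h | h
    · rw [h] at hdvd
      exact absurd hdvd hπ.not_dvd_one
    · rw [h, Nat.prime_dvd_prime_iff_eq hπ (hprime _)] at hdvd
      exact ⟨(⟨i, hi⟩, 0), hdvd, h⟩
    · rw [h, Nat.prime_dvd_prime_iff_eq hπ (hprime _)] at hdvd
      exact ⟨(⟨i, hi⟩, 1), hdvd, h⟩
  have hmem : ∀ a b, (a = b ∨ a.1 ≠ b.1) → ∃ d ∈ cd G, q a ∣ d ∧ q b ∣ d := by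
    intro a b hab
    -- Take `q a` and `q b` in their own factors and `1` elsewhere; the case `a = b` shows that each
    -- `q a` is a vertex.
    let f : ℕ → ℕ := fun i => if i = a.1 then q a else if i = b.1 then q b else 1
    have hfa : f a.1 = q a := if_pos rfl
    have hfb : f b.1 = q b := by
      rcases hab with rfl | hab
      · exact hfa
      · exact (if_neg fun h => hab (Fin.ext h.symm)).trans (if_pos rfl)
    have hqf : ∀ c : Fin k × Fin 2, q c = Q (2 * c.1) ∨ q c = Q (2 * c.1 + 1) := by
      rintro ⟨c, i⟩
      fin_cases i
      · exact Or.inl rfl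
      · exact Or.inr rfl
    refine ⟨_, (hcd _).2 ⟨f, fun i => ?_, rfl⟩, ?_, ?_⟩
    · by_cases ha : i = a.1
      · subst ha
        rw [hfa]
        exact Or.inr (hqf a)
      · by_cases hb : i = b.1
        · subst hb
          rw [hfb]
          exact Or.inr (hqf b)
        · exact Or.inl ((if_neg ha).trans (if_neg hb))
    · rw [← hfa]
      exact Finset.dvd_prod_of_mem f (Finset.mem_range.2 a.1.2)
    · rw [← hfb]
      exact Finset.dvd_prod_of_mem f (Finset.mem_range.2 b.1.2)
  refine ⟨G, _, inferInstance, hG, q, hq, ?_, fun a b hab => ⟨?_, fun h => ?_⟩⟩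
  · ext π
    constructor
    · rintro ⟨a, rfl⟩
      obtain ⟨d, hd, h, -⟩ := hmem a a (Or.inl rfl)
      exact ⟨hqp a, d, hd, h⟩
    · rintro ⟨hπ, d, hd, hdvd⟩
      obtain ⟨f, hf, rfl⟩ := (hcd d).1 hd
      obtain ⟨a, ha, -⟩ := hval hf hπ hdvd
      exact ⟨a, ha.symm⟩
  · rintro ⟨d, hd, hdvd⟩ h
    obtain ⟨f, hf, rfl⟩ := (hcd d).1 hd
    obtain ⟨a', ha', hfa⟩ := hval hf (hqp a) (dvd_of_mul_right_dvd hdvd)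
    obtain ⟨b', hb', hfb⟩ := hval hf (hqp b) (dvd_of_mul_left_dvd hdvd)
    obtain rfl := hq ha'
    obtain rfl := hq hb'
    rw [h, hfb] at hfa
    exact hab (hq hfa.symm)
  · obtain ⟨d, hd, ha, hb⟩ := hmem a b (Or.inr h)
    exact ⟨d, hd, Nat.Coprime.mul_dvd_of_dvd_of_dvd
      ((Nat.coprime_primes (hqp a) (hqp b)).2 fun e => hab (hq e)) ha hb⟩

end CharDegree

theorem theorem3p5 (n : ℕ) (hn : 4 ≤ n) (heven : Even n)
    {V : Type*} [Fintype V] (Γ : SimpleGraph V) [DecidableRel Γ.Adj]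
    (hcard : Fintype.card V = n) (hreg : Γ.IsRegularOfDegree (n - 2)) :
    ∃ (G : Type) (_ : Group G) (_ : Finite G),
      Group.IsSolvable G ∧ Nonempty (Γ ≃g CharDegree.degreeGraph G) := by
  subst hcard
  obtain ⟨k, e, he⟩ := hreg.exists_equiv_prod_fin_two (by omega)
  obtain ⟨G, _, _, hG, q, hq, hrange, hadj⟩ := CharDegree.exists_degreeGraph_eq k
  let E : V ≃ CharDegree.degreePrimes G :=
    (e.trans (Equiv.ofInjective q hq)).trans (Equiv.setCongr hrange)
  have hE : ∀ v, (E v : ℕ) = q (e v) := fun v => rfl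
  refine ⟨G, _, inferInstance, hG, ⟨⟨E, fun {v w} => ?_⟩⟩⟩
  change (E v ≠ E w ∧ ∃ d ∈ CharDegree.cd G, (E v : ℕ) * (E w : ℕ) ∣ d) ↔ Γ.Adj v w
  rw [he, hE, hE, E.injective.ne_iff]
  constructor
  · rintro ⟨hvw, h⟩
    exact (hadj _ _ fun h => hvw (e.injective h)).1 h
  · intro h
    have hvw : e v ≠ e w := fun h' => h (congrArg Prod.fst h')
    exact ⟨fun h' => hvw (congrArg e h'), (hadj _ _ hvw).2 h⟩
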